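/- Let $F$ be the distribution of a real random variable $Y$ with $E\,Y^2<\infty$; write $F(x)=P(Y\le x)$ for its distribution function. For $\tau\in(0,1)$ let $$S_\tau(x,y)=\tfrac{\tau}{2}\big[((y-x)^+)^2-(y^+)^2\big]+\tfrac{1-\tau}{2}\big[((y-x)^-)^2-(y^-)^2\big],$$ where $z^+=\max(z,0)$ and $z^-=\max(-z,0)$, and for a probability distribution $G$ on $\mathbb R$ with finite mean let the $\tau$-expectile $\mu_\tau(G)$ be the unique minimizer over $x\in\mathbb R$ of $x\mapsto\int S_\tau(x,y)\,dG(y)$. Put $\mu_\tau=\mu_\tau(F)$ and $$I_\tau(x,y)=\tau\,(y-x)\,1_{\{y\ge x\}}-(1-\tau)\,(x-y)\,1_{\{y<x\}}.$$ Let $Y_1,Y_2,\dots$ be i.i.d. with distribution $F$, let $\hat F_n=\frac1n\sum_{k=1}^n\delta_{Y_k}$ be the empirical distribution, and let $\hat\mu_{\tau,n}=\mu_\tau(\hat F_n)$ be the empirical $\tau$-expectile. Let $\tau_1,\dots,\tau_m\in(0,1)$ be such that $F$ has no point mass at any of $\mu_{\tau_1},\dots,\mu_{\tau_m}$. Then $$\sqrt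 n\,\big(\hat\mu_{\tau_1,n}-\mu_{\tau_1},\dots,\hat\mu_{\tau_m,n}-\mu_{\tau_m}\big)'\ \xrightarrow{\ \mathcal L\ }\ N(0,\Sigma)\qquad(n\to\infty),$$ where $\Sigma$ is the (positive semidefinite) $m\times m$ matrix with entries $$\Sigma_{i,j}=\frac{E\big[I_{\tau_i}(\mu_{\tau_i},Y)\,I_{\tau_j}(\mu_{\tau_j},Y)\big]}{d_i\,d_j},\qquad d_i=\tau_i\big(1-F(\mu_{\tau_i})\big)+(1-\tau_i)F(\mu_{\tau_i}).$$ -/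

import Mathlib

open MeasureTheory ProbabilityTheory Filter
open scoped ENNReal Topology

noncomputable section

namespace Expectile

/-- The asymmetric quadratic scoring function
`S_τ(x, y) = τ/2 [((y - x)⁺)² - (y⁺)²] + (1 - τ)/2 [((y - x)⁻)² - (y⁻)²]`,
with `z⁺ = max z 0` and `z⁻ = max (-z) 0`. -/
def score (τ x y : ℝ) : ℝ :=
  τ / 2 * ((max (y - x) 0) ^ 2 - (max y 0) ^ 2)
    + (1 - τ) / 2 * ((max (-(y - x)) 0) ^ 2 - (max (-y) 0) ^ 2)

/-- The identification function
`I_τ(x, y) = τ (y - x) 1{y ≥ x} - (1 - τ) (x - y) 1{y < x}`. -/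
def ident (τ x y : ℝ) : ℝ :=
  τ * (if x ≤ y then y - x else 0) - (1 - τ) * (if y < x then x - y else 0)

/-- `m` minimizes `x ↦ E S_τ(x, Y)` over `ℝ`, where `Y` has law `ν`. -/
def IsExpectile (ν : Measure ℝ) (τ m : ℝ) : Prop :=
  IsMinOn (fun x => ∫ y, score τ x y ∂ν) Set.univ m

/-- The `τ`-expectile `μ_τ(ν)`: the minimizer of `x ↦ E S_τ(x, Y)`, `Y ∼ ν`. It exists and is
unique if `ν` is a probability measure with finite mean and `0 < τ < 1`
(see `existsUnique_isExpectile`). -/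
def expectile (ν : Measure ℝ) (τ : ℝ) : ℝ :=
  Classical.epsilon (IsExpectile ν τ)

/-- The empirical measure `(1/n) ∑_{k < n} δ_{Y k ω}` (the zero measure for `n = 0`). -/
def empiricalMeasure {Ω : Type*} (Y : ℕ → Ω → ℝ) (n : ℕ) (ω : Ω) : Measure ℝ :=
  (n : ℝ≥0∞)⁻¹ • ∑ k ∈ Finset.range n, Measure.dirac (Y k ω)

/-- The empirical `τ`-expectile: the `τ`-expectile of the empirical measure. -/
def sampleExpectile {Ω : Type*} (Y : ℕ → Ω → ℝ) (τ : ℝ) (n : ℕ) (ω : Ω) : ℝ :=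
  expectile (empiricalMeasure Y n ω) τ

/-- The denominator `d = τ (1 - F(μ_τ)) + (1 - τ) F(μ_τ)`, with `F` the distribution function
of `ν`. -/
def slope (ν : Measure ℝ) (τ : ℝ) : ℝ :=
  τ * (1 - cdf ν (expectile ν τ)) + (1 - τ) * cdf ν (expectile ν τ)

/-- The asymptotic covariance matrix. -/
def asympCov (ν : Measure ℝ) {m : ℕ} (τ : Fin m → ℝ) : Matrix (Fin m) (Fin m) ℝ :=
  Matrix.of fun i j =>
    (∫ y, ident (τ i) (expectile ν (τ i)) y * ident (τ j) (expectile ν (τ j)) y ∂ν)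
      / (slope ν (τ i) * slope ν (τ j))

/-! ### Existence and uniqueness of the expectile -/

lemma continuous_score (τ : ℝ) : Continuous fun p : ℝ × ℝ => score τ p.1 p.2 := by
  unfold score; fun_prop

lemma abs_score_le {τ : ℝ} (h0 : 0 < τ) (h1 : τ < 1) (x y : ℝ) :
    |score τ x y| ≤ x ^ 2 + 2 * |x| * |y| := by
  have key : ∀ a b : ℝ, |(max a 0) ^ 2 - (max b 0) ^ 2| ≤ |a - b| * (|a - b| + 2 * |b|) := by
    intro a b
    have h2 : |max a 0 - max b 0| ≤ |a - b| := abs_max_sub_max_le_abs a b 0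
    have h3 : |max a 0 + max b 0| ≤ |a - b| + 2 * |b| := by
      have : max b 0 ≤ |b| := max_le (le_abs_self b) (abs_nonneg b)
      have h5 : max a 0 ≤ |a - b| + |b| := by
        refine max_le ?_ (by positivity)
        have := le_abs_self (a - b); have := le_abs_self b; linarith
      rw [abs_of_nonneg (by positivity)]; linarith
    rw [sq_sub_sq, abs_mul, mul_comm]
    exact mul_le_mul h2 h3 (abs_nonneg _) (abs_nonneg _)
  have k1 := key (y - x) y
  have k2 := key (-(y - x)) (-y)
  have e1 : |y - x - y| = |x| := by rw [show y - x - y = -x by ring, abs_neg]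
  have e2 : |-(y - x) - -y| = |x| := by rw [show -(y - x) - -y = x by ring]
  rw [e1] at k1
  rw [e2, abs_neg] at k2
  have hx : |x| * (|x| + 2 * |y|) = x ^ 2 + 2 * |x| * |y| := by
    rw [← sq_abs x]; ring
  rw [hx] at k1 k2
  have hnn : 0 ≤ x ^ 2 + 2 * |x| * |y| := by positivity
  unfold score
  refine (abs_add_le _ _).trans ?_
  rw [abs_mul, abs_mul, abs_of_pos (by linarith : 0 < τ / 2),
    abs_of_pos (by linarith : 0 < (1 - τ) / 2)]
  nlinarith

lemma integrable_score {ν : Measure ℝ} [IsProbabilityMeasure ν] (hν : Integrable id ν) {τ : ℝ}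
    (h0 : 0 < τ) (h1 : τ < 1) (x : ℝ) : Integrable (fun y => score τ x y) ν := by
  have hb : Integrable (fun y : ℝ => x ^ 2 + 2 * |x| * |y|) ν :=
    (integrable_const _).add (hν.abs.const_mul _)
  refine hb.mono' ?_ (ae_of_all _ fun y => abs_score_le h0 h1 x y)
  exact ((continuous_score τ).comp (by fun_prop : Continuous fun y : ℝ => (x, y))
    ).aestronglyMeasurable

lemma continuous_integral_score {ν : Measure ℝ} [IsProbabilityMeasure ν] (hν : Integrable id ν)
    {τ : ℝ} (h0 : 0 < τ) (h1 : τ < 1) : Continuous fun x => ∫ y, score τ x y ∂ν := by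
  rw [continuous_iff_continuousAt]
  intro x₀
  refine continuousAt_of_dominated
    (bound := fun y => (|x₀| + 1) ^ 2 + 2 * (|x₀| + 1) * |y|) ?_ ?_ ?_ ?_
  · exact Eventually.of_forall fun x => (integrable_score hν h0 h1 x).aestronglyMeasurable
  · filter_upwards [Metric.ball_mem_nhds x₀ one_pos] with x hx
    refine ae_of_all _ fun y => (abs_score_le h0 h1 x y).trans ?_
    have hx' : |x| ≤ |x₀| + 1 := by
      rw [Metric.mem_ball, Real.dist_eq] at hx
      have := abs_sub_abs_le_abs_sub x x₀
      linarith
    rw [← sq_abs x]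
    gcongr
  · exact (integrable_const _).add (hν.abs.const_mul _)
  · exact ae_of_all _ fun y =>
      ((continuous_score τ).comp (by fun_prop : Continuous fun x : ℝ => (x, y))).continuousAt

lemma score_lower {τ : ℝ} (h0 : 0 < τ) (h1 : τ < 1) (x y : ℝ) :
    min τ (1 - τ) / 2 * x ^ 2 - |x| * |y| ≤ score τ x y := by
  have hc1 := min_le_left τ (1 - τ)
  have hc2 := min_le_right τ (1 - τ)
  have hc0 : 0 < min τ (1 - τ) := lt_min h0 (by linarith)
  generalize min τ (1 - τ) = c at *
  rw [← abs_mul]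
  have ha := le_abs_self (x * y)
  have hb := neg_abs_le (x * y)
  unfold score
  rcases le_total 0 y with hy | hy <;> rcases le_total x y with hxy | hxy
  · rw [max_eq_left (by linarith), max_eq_left hy, max_eq_right (by linarith),
      max_eq_right (by linarith)]
    nlinarith [mul_nonneg (sub_nonneg.2 hc1) (sq_nonneg x), abs_nonneg (x * y)]
  · rw [max_eq_right (by linarith), max_eq_left hy, max_eq_left (by linarith),
      max_eq_right (by linarith)]
    nlinarith [mul_nonneg (sub_nonneg.2 hc1) (sq_nonneg x), abs_nonneg (x * y),
      mul_nonneg (sub_nonneg.2 hc2) (sq_nonneg (x - y)),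
      mul_nonneg (sub_nonneg.2 hc1) (sq_nonneg y), mul_nonneg hy (sub_nonneg.2 hxy)]
  · rw [max_eq_left (by linarith), max_eq_right hy, max_eq_right (by linarith),
      max_eq_left (by linarith)]
    nlinarith [mul_nonneg (sub_nonneg.2 hc1) (sq_nonneg (y - x)), abs_nonneg (x * y),
      mul_nonneg (sub_nonneg.2 hc2) (sq_nonneg y),
      mul_nonneg (neg_nonneg.2 hy) (sub_nonneg.2 hxy)]
  · rw [max_eq_right (by linarith), max_eq_right hy, max_eq_left (by linarith),
      max_eq_left (by linarith)]
    nlinarith [mul_nonneg (sub_nonneg.2 hc2) (sq_nonneg x), abs_nonneg (x * y)]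

/-- Strict midpoint convexity of `x ↦ S_τ(x, y)`. -/
lemma score_midpoint {τ : ℝ} (h0 : 0 < τ) (h1 : τ < 1) (a b y : ℝ) :
    score τ ((a + b) / 2) y + min τ (1 - τ) / 8 * (a - b) ^ 2
      ≤ (score τ a y + score τ b y) / 2 := by
  have hc1 := min_le_left τ (1 - τ)
  have hc2 := min_le_right τ (1 - τ)
  have hc0 : 0 < min τ (1 - τ) := lt_min h0 (by linarith)
  generalize min τ (1 - τ) = c at *
  have e : ∀ z : ℝ, τ / 2 * (max z 0) ^ 2 + (1 - τ) / 2 * (max (-z) 0) ^ 2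
      = c / 2 * z ^ 2 + (τ - c) / 2 * (max z 0) ^ 2 + (1 - τ - c) / 2 * (max (-z) 0) ^ 2 := by
    intro z
    rcases le_total 0 z with hz | hz
    · rw [max_eq_left hz, max_eq_right (by linarith)]; ring
    · rw [max_eq_right hz, max_eq_left (by linarith)]; ring
  have mid : ∀ u v : ℝ, (max ((u + v) / 2) 0) ^ 2 ≤ ((max u 0) ^ 2 + (max v 0) ^ 2) / 2 := by
    intro u v
    have h : max ((u + v) / 2) 0 ≤ (max u 0 + max v 0) / 2 := by
      refine max_le ?_ (by positivity)
      have := le_max_left u 0; have := le_max_left v 0; linarith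
    have h' : 0 ≤ max ((u + v) / 2) 0 := le_max_right _ _
    nlinarith [sq_nonneg (max u 0 - max v 0)]
  have m1 := mid (y - a) (y - b)
  have m2 := mid (-(y - a)) (-(y - b))
  rw [show (y - a + (y - b)) / 2 = y - (a + b) / 2 by ring] at m1
  rw [show (-(y - a) + -(y - b)) / 2 = -(y - (a + b) / 2) by ring] at m2
  have ea := e (y - a)
  have eb := e (y - b)
  have em := e (y - (a + b) / 2)
  have p1 := mul_le_mul_of_nonneg_left m1 (by linarith : 0 ≤ (τ - c) / 2)
  have p2 := mul_le_mul_of_nonneg_left m2 (by linarith : 0 ≤ (1 - τ - c) / 2)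
  unfold score
  nlinarith

/-- A probability measure with finite mean has exactly one `τ`-expectile. -/
theorem existsUnique_isExpectile {ν : Measure ℝ} [IsProbabilityMeasure ν] (hν : Integrable id ν)
    {τ : ℝ} (h0 : 0 < τ) (h1 : τ < 1) : ∃! x, IsExpectile ν τ x := by
  have hc0 : 0 < min τ (1 - τ) := lt_min h0 (by linarith)
  have hlow : ∀ x, min τ (1 - τ) / 2 * x ^ 2 - |x| * ∫ y, |y| ∂ν ≤ ∫ y, score τ x y ∂ν := by
    intro x
    have := integral_mono (μ := ν)
      ((integrable_const (min τ (1 - τ) / 2 * x ^ 2)).sub (hν.abs.const_mul |x|))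
      (integrable_score hν h0 h1 x) (fun y => score_lower h0 h1 x y)
    have e := integral_sub (integrable_const (μ := ν) (min τ (1 - τ) / 2 * x ^ 2))
      (hν.abs.const_mul |x|)
    rw [integral_const, probReal_univ, one_smul] at e
    rw [← integral_const_mul]
    exact e.symm.trans_le this
  have hcoer : Tendsto (fun x => ∫ y, score τ x y ∂ν) (cocompact ℝ) atTop := by
    refine tendsto_atTop_mono hlow ?_
    have h : Tendsto (fun r : ℝ => r * (min τ (1 - τ) / 2 * r - ∫ y, |y| ∂ν)) atTop atTop := by
      refine tendsto_id.atTop_mul_atTop₀ ?_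
      exact tendsto_atTop_add_const_right _ _ (tendsto_id.const_mul_atTop (by linarith))
    have h2 := h.comp (tendsto_norm_cocompact_atTop (E := ℝ))
    refine h2.congr fun x => ?_
    simp only [Function.comp, Real.norm_eq_abs]
    rw [← sq_abs x]; ring
  obtain ⟨m, hm⟩ := (continuous_integral_score hν h0 h1).exists_forall_le hcoer
  refine ⟨m, fun x _ => hm x, fun m' hm' => ?_⟩
  by_contra hne
  have hm'' : ∀ x, ∫ y, score τ m' y ∂ν ≤ ∫ y, score τ x y ∂ν := fun x => hm' (Set.mem_univ x)
  have hI := integral_mono (μ := ν)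
    ((integrable_score hν h0 h1 ((m' + m) / 2)).add
      (integrable_const (min τ (1 - τ) / 8 * (m' - m) ^ 2)))
    (((integrable_score hν h0 h1 m').add (integrable_score hν h0 h1 m)).div_const 2)
    (fun y => score_midpoint h0 h1 m' m y)
  simp only [Pi.add_apply] at hI
  rw [integral_add (integrable_score hν h0 h1 _) (integrable_const _), integral_div,
    integral_add (integrable_score hν h0 h1 _) (integrable_score hν h0 h1 _)] at hI
  simp only [integral_const, probReal_univ, one_smul] at hI
  have hpos : 0 < min τ (1 - τ) / 8 * (m' - m) ^ 2 := by
    have : m' - m ≠ 0 := sub_ne_zero.2 hne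
    positivity
  have := hm ((m' + m) / 2)
  have := hm'' m
  have := hm m'
  linarith

/-- The expectile does minimize the expected score. -/
theorem isExpectile_expectile {ν : Measure ℝ} [IsProbabilityMeasure ν] (hν : Integrable id ν)
    {τ : ℝ} (h0 : 0 < τ) (h1 : τ < 1) : IsExpectile ν τ (expectile ν τ) :=
  Classical.epsilon_spec (existsUnique_isExpectile hν h0 h1).exists

end Expectile

end

/-!
The expectile is a Z-estimator with a strongly monotone estimating function, and no empirical
process theory is needed. Write `c = min τ (1 - τ) > 0`, `μ = expectile F τ`, `d = slope F τ`, and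
for a probability measure `ν` put `D(ν) = ∫ ident τ μ y ∂ν`.

* `ident τ x y` is minus the derivative of the score in `x`, so that `∫ ident τ x y ∂ν` vanishes at
  `x = expectile ν τ` (`integral_ident_expectile`), and it decreases in `x` at rate at least `c`.
  Hence `c |expectile ν τ - μ| ≤ |D(ν)|` (`mul_abs_expectile_sub_le`), which gives consistency, and
  `a ≤ expectile ν τ ↔ 0 ≤ ∫ ident τ a y ∂ν` (`le_expectile_iff`), which gives measurability of the
  empirical expectile.
* `x ↦ ident τ x y` is piecewise linear with its only kink at `x = y`. Replacing it by its
  linearization at `μ` therefore costs at most `|x - μ|`, and only if `|y - μ| ≤ |x - μ|`. So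
  `D(ν) - d (expectile ν τ - μ)` is at most `|expectile ν τ - μ|` times the sum of an error in the
  mean slope and of the `ν`-mass of a small ball around `μ` (`abs_integral_ident_sub_le`). For
  empirical measures the strong law of large numbers makes both tend to zero, the second because
  `μ` is not an atom of `F`. Thus the quotient `linRatio` of `expectile ν τ - μ` by `D(ν) / d` tends
  to one almost surely (`ae_tendsto_linRatio`).
* The vector with components `√n D(ν) / d`, for `ν` the empirical measure, is a normalized sum of
  centred i.i.d. random vectors with covariance matrix `asympCov`
  (`tendstoInDistribution_multivariateGaussian`). Since the normalized estimation error is *exactly*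
  its componentwise product with the vector of the quotients `linRatio`, Slutsky's theorem concludes.
-/

namespace Expectile

/-! ### The identification function -/

lemma ident_eq (τ x y : ℝ) :
    ident τ x y = τ * max (y - x) 0 - (1 - τ) * max (x - y) 0 := by
  unfold ident
  rcases lt_or_ge y x with h | h
  · rw [if_neg h.not_ge, if_pos h, max_eq_right (by linarith), max_eq_left (by linarith)]
  · rw [if_pos h, if_neg h.not_gt, max_eq_left (by linarith), max_eq_right (by linarith)]

lemma continuous_ident (τ x : ℝ) : Continuous (ident τ x) := by
  rw [show ident τ x = _ from funext (ident_eq τ x)]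
  fun_prop

lemma abs_ident_le {τ : ℝ} (h0 : 0 < τ) (h1 : τ < 1) (x y : ℝ) :
    |ident τ x y| ≤ |x| + |y| := by
  have hx := neg_abs_le x
  have hx' := le_abs_self x
  have hy := neg_abs_le y
  have hy' := le_abs_self y
  unfold ident
  rw [abs_le]
  rcases lt_or_ge y x with h | h
  · rw [if_neg h.not_ge, if_pos h]
    constructor <;> nlinarith
  · rw [if_pos h, if_neg h.not_gt]
    constructor <;> nlinarith

lemma integrable_ident {ν : Measure ℝ} [IsProbabilityMeasure ν] (hν : Integrable id ν) {τ : ℝ}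
    (h0 : 0 < τ) (h1 : τ < 1) (x : ℝ) : Integrable (ident τ x) ν :=
  ((integrable_const |x|).add hν.abs).mono' (continuous_ident τ x).aestronglyMeasurable
    (ae_of_all _ fun y => abs_ident_le h0 h1 x y)

lemma memLp_two_ident {ν : Measure ℝ} [IsProbabilityMeasure ν] (hν : MemLp id 2 ν) {τ : ℝ}
    (h0 : 0 < τ) (h1 : τ < 1) (x : ℝ) : MemLp (ident τ x) 2 ν :=
  ((memLp_const |x|).add hν.norm).mono' (continuous_ident τ x).aestronglyMeasurable
    (ae_of_all _ fun y => abs_ident_le h0 h1 x y)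

lemma ident_sub_ident_ge {τ : ℝ} (h0 : 0 < τ) (h1 : τ < 1) {x x' : ℝ} (hx : x ≤ x') (y : ℝ) :
    min τ (1 - τ) * (x' - x) ≤ ident τ x y - ident τ x' y := by
  have hc1 := min_le_left τ (1 - τ)
  have hc2 := min_le_right τ (1 - τ)
  generalize min τ (1 - τ) = c at *
  unfold ident
  split_ifs <;> first | linarith | nlinarith

/-- The identification function is minus the derivative of the score in its first argument; the
second-order error is at most `h² / 2` because that derivative is `1`-Lipschitz. -/
lemma score_add_le {τ : ℝ} (h0 : 0 < τ) (h1 : τ < 1) (x h y : ℝ) :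
    score τ (x + h) y ≤ score τ x y - h * ident τ x y + h ^ 2 / 2 := by
  have key : ∀ u h : ℝ, (max (u - h) 0) ^ 2 ≤ (max u 0 - h) ^ 2 := by
    intro u h
    rcases le_total (u - h) 0 with h' | h'
    · rw [max_eq_right h']; nlinarith [sq_nonneg (max u 0 - h)]
    · rw [max_eq_left h']
      have := le_max_left u 0
      exact pow_le_pow_left₀ h' (by linarith) 2
  have k1 := key (y - x) h
  have k2 := key (-(y - x)) (-h)
  rw [show y - x - h = y - (x + h) by ring] at k1
  rw [show -(y - x) - -h = -(y - (x + h)) by ring] at k2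
  rw [ident_eq, show x - y = -(y - x) by ring]
  unfold score
  have p1 := mul_le_mul_of_nonneg_left k1 (by linarith : 0 ≤ τ / 2)
  have p2 := mul_le_mul_of_nonneg_left k2 (by linarith : 0 ≤ (1 - τ) / 2)
  nlinarith

/-! ### The expectile as the zero of the mean identification function -/

lemma integral_ident_expectile {ν : Measure ℝ} [IsProbabilityMeasure ν] (hν : Integrable id ν)
    {τ : ℝ} (h0 : 0 < τ) (h1 : τ < 1) : ∫ y, ident τ (expectile ν τ) y ∂ν = 0 := by
  set x := expectile ν τ with hx
  set e := ∫ y, ident τ x y ∂ν with he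
  -- moving from `x` by `e` would decrease the expected score by at least `e² / 2`
  have hmin : ∫ y, score τ x y ∂ν ≤ ∫ y, score τ (x + e) y ∂ν :=
    isExpectile_expectile hν h0 h1 (Set.mem_univ (x + e))
  have hi1 := integrable_score hν h0 h1 x
  have hi2 := (integrable_ident hν h0 h1 x).const_mul e
  have hle : ∫ y, score τ (x + e) y ∂ν
      ≤ ∫ y, (score τ x y - e * ident τ x y + e ^ 2 / 2) ∂ν :=
    integral_mono (integrable_score hν h0 h1 (x + e)) ((hi1.sub hi2).add (integrable_const _))
      fun y => score_add_le h0 h1 x e y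
  rw [integral_add (f := fun y => score τ x y - e * ident τ x y) (hi1.sub hi2)
    (integrable_const _), integral_sub hi1 hi2, integral_const_mul,
    integral_const, probReal_univ, one_smul, ← he] at hle
  nlinarith [sq_nonneg e]

lemma integral_ident_sub_ge {ν : Measure ℝ} [IsProbabilityMeasure ν] (hν : Integrable id ν)
    {τ : ℝ} (h0 : 0 < τ) (h1 : τ < 1) {x x' : ℝ} (hx : x ≤ x') :
    min τ (1 - τ) * (x' - x) ≤ ∫ y, ident τ x y ∂ν - ∫ y, ident τ x' y ∂ν := by
  have hi := integrable_ident hν h0 h1 x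
  have hi' := integrable_ident hν h0 h1 x'
  have h := integral_mono (μ := ν) (integrable_const (min τ (1 - τ) * (x' - x))) (hi.sub hi')
    fun y => ident_sub_ident_ge h0 h1 hx y
  rwa [integral_const, probReal_univ, one_smul, integral_sub' hi hi'] at h

lemma le_expectile_iff {ν : Measure ℝ} [IsProbabilityMeasure ν] (hν : Integrable id ν)
    {τ : ℝ} (h0 : 0 < τ) (h1 : τ < 1) (x : ℝ) :
    x ≤ expectile ν τ ↔ 0 ≤ ∫ y, ident τ x y ∂ν := by
  have hc : 0 < min τ (1 - τ) := lt_min h0 (by linarith)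
  have h := integral_ident_expectile hν h0 h1
  constructor
  · intro hx
    have := integral_ident_sub_ge hν h0 h1 hx
    rw [h] at this
    nlinarith
  · intro hx
    by_contra! hlt
    have := integral_ident_sub_ge hν h0 h1 hlt.le
    rw [h] at this
    nlinarith

/-- The expectile is close to every point at which the mean identification function is small. -/
lemma mul_abs_expectile_sub_le {ν : Measure ℝ} [IsProbabilityMeasure ν] (hν : Integrable id ν)
    {τ : ℝ} (h0 : 0 < τ) (h1 : τ < 1) (x : ℝ) :
    min τ (1 - τ) * |expectile ν τ - x| ≤ |∫ y, ident τ x y ∂ν| := by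
  have h := integral_ident_expectile hν h0 h1
  rcases le_total x (expectile ν τ) with hx | hx
  · have := integral_ident_sub_ge hν h0 h1 hx
    rw [h, sub_zero] at this
    rw [abs_of_nonneg (sub_nonneg.2 hx)]
    exact this.trans (le_abs_self _)
  · have := integral_ident_sub_ge hν h0 h1 hx
    rw [h, zero_sub] at this
    rw [abs_sub_comm, abs_of_nonneg (sub_nonneg.2 hx)]
    exact this.trans (neg_le_abs _)

/-! ### Linearization at the expectile -/

/-- Minus the derivative of `x ↦ I_τ(x, y)`, which is `τ` for `y > x` and `1 - τ` for `y < x`; at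
the kink `y = x` it is given the value `1 - τ`, which matches the distribution function
`P(Y ≤ x)` in `slope`. -/
noncomputable def weight (τ x y : ℝ) : ℝ := τ + (1 - 2 * τ) * (Set.Iic x).indicator 1 y

lemma measurable_weight (τ x : ℝ) : Measurable (weight τ x) :=
  ((measurable_one.indicator measurableSet_Iic).const_mul _).const_add _

lemma integrable_indicator_one (ν : Measure ℝ) [IsFiniteMeasure ν] {s : Set ℝ}
    (hs : MeasurableSet s) : Integrable (s.indicator (1 : ℝ → ℝ)) ν :=
  (integrable_const (1 : ℝ)).indicator hs

lemma integrable_weight (ν : Measure ℝ) [IsFiniteMeasure ν] (τ x : ℝ) :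
    Integrable (weight τ x) ν :=
  (integrable_const τ).add ((integrable_indicator_one ν measurableSet_Iic).const_mul _)

lemma integral_weight_expectile (F : Measure ℝ) [IsProbabilityMeasure F] (τ : ℝ) :
    ∫ y, weight τ (expectile F τ) y ∂F = slope F τ := by
  unfold weight slope
  rw [integral_add (integrable_const _)
    ((integrable_indicator_one F measurableSet_Iic).const_mul _), integral_const_mul,
    integral_indicator_one measurableSet_Iic, integral_const, probReal_univ, one_smul, cdf_eq_real]
  ring

lemma slope_pos (F : Measure ℝ) {τ : ℝ} (h0 : 0 < τ) (h1 : τ < 1) : 0 < slope F τ := by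
  have ha := cdf_nonneg F (expectile F τ)
  have hb := cdf_le_one F (expectile F τ)
  have hc1 := min_le_left τ (1 - τ)
  have hc2 := min_le_right τ (1 - τ)
  have hc : 0 < min τ (1 - τ) := lt_min h0 (by linarith)
  unfold slope
  nlinarith

/-- First-order expansion of the identification function in `x`. The linear approximation is exact
unless `y` lies between `x₀` and `x`, hence within `δ` of `x₀`. -/
lemma abs_ident_sub_linear_le {τ : ℝ} (h0 : 0 < τ) (h1 : τ < 1) {x x₀ δ : ℝ}
    (hδ : |x - x₀| ≤ δ) (y : ℝ) :
    |ident τ x₀ y - ident τ x y - (x - x₀) * weight τ x₀ y|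
      ≤ |x - x₀| * (Metric.closedBall x₀ δ).indicator 1 y := by
  have hδ' := abs_le.1 hδ
  have hrhs : 0 ≤ |x - x₀| * (Metric.closedBall x₀ δ).indicator (1 : ℝ → ℝ) y :=
    mul_nonneg (abs_nonneg _) (Set.indicator_nonneg (fun _ _ => zero_le_one) _)
  have hin : |y - x₀| ≤ δ → (Metric.closedBall x₀ δ).indicator (1 : ℝ → ℝ) y = 1 := fun h =>
    Set.indicator_of_mem (by rwa [Metric.mem_closedBall, Real.dist_eq]) _
  unfold ident weight
  rcases le_or_gt y x₀ with hy | hy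
  · rw [Set.indicator_of_mem (Set.mem_Iic.2 hy), Pi.one_apply]
    rcases le_or_gt x y with hxy | hxy
    · rw [hin (abs_le.2 ⟨by linarith, by linarith⟩), mul_one,
        abs_of_nonpos (by linarith : x - x₀ ≤ 0)]
      split_ifs <;> rw [abs_le] <;> constructor <;> nlinarith
    · convert hrhs
      rw [abs_eq_zero]
      split_ifs <;> first | (exfalso; linarith) | nlinarith
  · rw [Set.indicator_of_notMem (by simpa using hy)]
    rcases le_or_gt x y with hxy | hxy
    · convert hrhs
      rw [abs_eq_zero]
      split_ifs <;> linarith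
    · rw [hin (abs_le.2 ⟨by linarith, by linarith⟩), mul_one,
        abs_of_nonneg (by linarith : 0 ≤ x - x₀)]
      split_ifs <;> rw [abs_le] <;> constructor <;> nlinarith

/-- The expansion of the mean identification function under `ν` around `x₀`, evaluated at its zero
`expectile ν τ`, with an arbitrary candidate `d` for the slope. -/
lemma abs_integral_ident_sub_le {ν : Measure ℝ} [IsProbabilityMeasure ν] (hν : Integrable id ν)
    {τ : ℝ} (h0 : 0 < τ) (h1 : τ < 1) {x₀ δ : ℝ} (hδ : |expectile ν τ - x₀| ≤ δ) (d : ℝ) :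
    |∫ y, ident τ x₀ y ∂ν - (expectile ν τ - x₀) * d|
      ≤ |expectile ν τ - x₀| *
        (|∫ y, weight τ x₀ y ∂ν - d| + ν.real (Metric.closedBall x₀ δ)) := by
  set x := expectile ν τ with hx
  have hi := integrable_ident hν h0 h1 x
  have hi₀ := integrable_ident hν h0 h1 x₀
  have hw := (integrable_weight ν τ x₀).const_mul (x - x₀)
  have hball := measurableSet_closedBall (x := x₀) (ε := δ)
  have hrem : |∫ y, (ident τ x₀ y - ident τ x y - (x - x₀) * weight τ x₀ y) ∂ν|
      ≤ |x - x₀| * ν.real (Metric.closedBall x₀ δ) := by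
    rw [← integral_indicator_one hball, ← integral_const_mul]
    exact (abs_integral_le_integral_abs).trans
      (integral_mono ((hi₀.sub hi).sub hw).abs ((integrable_indicator_one ν hball).const_mul _)
        fun y => abs_ident_sub_linear_le h0 h1 hδ y)
  rw [integral_sub (f := fun y => ident τ x₀ y - ident τ x y) (hi₀.sub hi) hw,
    integral_sub hi₀ hi, integral_ident_expectile hν h0 h1, sub_zero, integral_const_mul] at hrem
  calc _ = |(∫ y, ident τ x₀ y ∂ν - (x - x₀) * ∫ y, weight τ x₀ y ∂ν)
          + (x - x₀) * (∫ y, weight τ x₀ y ∂ν - d)| := by ring_nf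
    _ ≤ |x - x₀| * ν.real (Metric.closedBall x₀ δ)
          + |x - x₀| * |∫ y, weight τ x₀ y ∂ν - d| := by
        refine (abs_add_le _ _).trans (add_le_add hrem (abs_mul _ _).le)
    _ = _ := by ring

/-- The quotient of `μ_τ(ν) - μ_τ(F)` by its linear approximation `∫ I_τ(μ_τ(F), y) dν(y) / d`.
Where the linear approximation vanishes, so does the difference, and the quotient is taken
to be `1`. -/
noncomputable def linRatio (F ν : Measure ℝ) (τ : ℝ) : ℝ :=
  if ∫ y, ident τ (expectile F τ) y ∂ν = 0 then 1
  else slope F τ * (expectile ν τ - expectile F τ) / ∫ y, ident τ (expectile F τ) y ∂ν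

lemma expectile_sub_eq_mul_linRatio (F : Measure ℝ) {ν : Measure ℝ} [IsProbabilityMeasure ν]
    (hν : Integrable id ν) {τ : ℝ} (h0 : 0 < τ) (h1 : τ < 1) :
    expectile ν τ - expectile F τ
      = (∫ y, ident τ (expectile F τ) y ∂ν) / slope F τ * linRatio F ν τ := by
  have hd := (slope_pos F h0 h1).ne'
  unfold linRatio
  split_ifs with h
  · have hc : 0 < min τ (1 - τ) := lt_min h0 (by linarith)
    have := mul_abs_expectile_sub_le hν h0 h1 (expectile F τ)
    rw [h, abs_zero] at this
    rw [h, zero_div, zero_mul]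
    exact abs_eq_zero.1 (le_antisymm (nonpos_of_mul_nonpos_right this hc) (abs_nonneg _))
  · field_simp

lemma abs_linRatio_sub_one_le (F : Measure ℝ) {ν : Measure ℝ} [IsProbabilityMeasure ν]
    (hν : Integrable id ν) {τ : ℝ} (h0 : 0 < τ) (h1 : τ < 1) {δ : ℝ}
    (hδ : |expectile ν τ - expectile F τ| ≤ δ) :
    |linRatio F ν τ - 1|
      ≤ (|∫ y, weight τ (expectile F τ) y ∂ν - slope F τ|
          + ν.real (Metric.closedBall (expectile F τ) δ)) / min τ (1 - τ) := by
  have hc : 0 < min τ (1 - τ) := lt_min h0 (by linarith)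
  have hlin := abs_integral_ident_sub_le hν h0 h1 hδ (slope F τ)
  have hmon := mul_abs_expectile_sub_le hν h0 h1 (expectile F τ)
  unfold linRatio
  generalize min τ (1 - τ) = c at *
  set e := |∫ y, weight τ (expectile F τ) y ∂ν - slope F τ|
          + ν.real (Metric.closedBall (expectile F τ) δ) with he
  have he0 : 0 ≤ e := by positivity
  split_ifs with h
  · rw [sub_self, abs_zero]; positivity
  · set D := ∫ y, ident τ (expectile F τ) y ∂ν
    rw [div_sub_one h, abs_div, div_le_div_iff₀ (abs_pos.2 h) hc, abs_sub_comm,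
      mul_comm (slope F τ)]
    calc _ ≤ |expectile ν τ - expectile F τ| * e * c := by gcongr
      _ = e * (c * |expectile ν τ - expectile F τ|) := by ring
      _ ≤ e * |D| := by gcongr

/-! ### Empirical measures -/

section Empirical

variable {Ω : Type*} {Y : ℕ → Ω → ℝ}

lemma integrable_empiricalMeasure (f : ℝ → ℝ) {n : ℕ} (hn : n ≠ 0) (ω : Ω) :
    Integrable f (empiricalMeasure Y n ω) :=
  (integrable_finsetSum_measure.2 fun _ _ => integrable_dirac (by simp)).smul_measure
    (by simpa using hn)

lemma isProbabilityMeasure_empiricalMeasure {n : ℕ} (hn : n ≠ 0) (ω : Ω) :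
    IsProbabilityMeasure (empiricalMeasure Y n ω) := by
  refine ⟨?_⟩
  simp [empiricalMeasure, ENNReal.inv_mul_cancel, hn]

lemma integral_empiricalMeasure (f : ℝ → ℝ) (n : ℕ) (ω : Ω) :
    ∫ y, f y ∂(empiricalMeasure Y n ω) = (∑ k ∈ Finset.range n, f (Y k ω)) / n := by
  unfold empiricalMeasure
  rw [integral_smul_measure,
    integral_finsetSum_measure fun _ _ => integrable_dirac (by simp)]
  simp [div_eq_inv_mul]

/-- The expectile of the empirical measure is a measurable function of the sample, here taken as the
coordinate process on `ℕ → ℝ`. -/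
lemma measurable_expectile_empiricalMeasure {τ : ℝ} (h0 : 0 < τ) (h1 : τ < 1) (n : ℕ) :
    Measurable fun y : ℕ → ℝ => expectile (empiricalMeasure (fun k (z : ℕ → ℝ) => z k) n y) τ := by
  rcases eq_or_ne n 0 with rfl | hn
  · simp [empiricalMeasure]
  -- superlevel sets of the expectile are those of the mean identification function
  refine measurable_of_Ici fun a => ?_
  have : (fun y : ℕ → ℝ => expectile (empiricalMeasure (fun k (z : ℕ → ℝ) => z k) n y) τ) ⁻¹'
      Set.Ici a = {y | 0 ≤ (∑ k ∈ Finset.range n, ident τ a (y k)) / n} := by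
    ext y
    have := isProbabilityMeasure_empiricalMeasure (Y := fun k (z : ℕ → ℝ) => z k) hn y
    rw [Set.mem_preimage, Set.mem_Ici, le_expectile_iff (integrable_empiricalMeasure _ hn y) h0 h1,
      integral_empiricalMeasure, Set.mem_ofPred_eq]
  rw [this]
  refine measurableSet_le measurable_const (Measurable.div_const ?_ _)
  exact Finset.measurable_sum _ fun k _ =>
    (continuous_ident τ a).measurable.comp (measurable_pi_apply k)

variable [MeasurableSpace Ω] {P : Measure Ω} {F : Measure ℝ}

lemma aemeasurable_sampleExpectile (hY : ∀ k, AEMeasurable (Y k) P) {τ : ℝ} (h0 : 0 < τ)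
    (h1 : τ < 1) (n : ℕ) : AEMeasurable (sampleExpectile Y τ n) P :=
  (measurable_expectile_empiricalMeasure h0 h1 n).comp_aemeasurable
    (aemeasurable_pi_lambda (fun ω k => Y k ω) hY)

lemma aemeasurable_integral_empiricalMeasure (hY : ∀ k, AEMeasurable (Y k) P) {f : ℝ → ℝ}
    (hf : Measurable f) (n : ℕ) :
    AEMeasurable (fun ω => ∫ y, f y ∂(empiricalMeasure Y n ω)) P := by
  simp_rw [integral_empiricalMeasure]
  exact (Finset.aemeasurable_fun_sum _ fun k _ => hf.comp_aemeasurable (hY k)).div_const _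

lemma aemeasurable_linRatio_empiricalMeasure (hY : ∀ k, AEMeasurable (Y k) P) {τ : ℝ}
    (h0 : 0 < τ) (h1 : τ < 1) (n : ℕ) :
    AEMeasurable (fun ω => linRatio F (empiricalMeasure Y n ω) τ) P := by
  have hD := aemeasurable_integral_empiricalMeasure hY
    (continuous_ident τ (expectile F τ)).measurable n
  have hx := aemeasurable_sampleExpectile hY h0 h1 n
  have hg : Measurable fun p : ℝ × ℝ =>
      if p.1 = 0 then (1 : ℝ) else slope F τ * (p.2 - expectile F τ) / p.1 :=
    Measurable.ite (measurable_fst (measurableSet_singleton 0)) measurable_const (by fun_prop)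
  exact hg.comp_aemeasurable (hD.prodMk hx)

/-- The strong law of large numbers for integrals against the empirical measure. -/
lemma ae_tendsto_integral_empiricalMeasure (hlaw : ∀ k, HasLaw (Y k) F P)
    (hindep : iIndepFun Y P) {f : ℝ → ℝ} (hf : Measurable f) (hint : Integrable f F) :
    ∀ᵐ ω ∂P, Tendsto (fun n => ∫ y, f y ∂(empiricalMeasure Y n ω)) atTop (𝓝 (∫ y, f y ∂F)) := by
  simp_rw [integral_empiricalMeasure]
  have hint' : Integrable (fun ω => f (Y 0 ω)) P := by
    have : Integrable f (P.map (Y 0)) := by rwa [(hlaw 0).map_eq]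
    exact this.comp_aemeasurable (hlaw 0).aemeasurable
  have h := strong_law_ae_real (μ := P) (fun k ω => f (Y k ω)) hint'
    (fun i j hij => (hindep.indepFun hij).comp hf hf)
    (fun k => ((hlaw k).identDistrib (hlaw 0)).comp hf)
  have e : ∫ ω, f (Y 0 ω) ∂P = ∫ y, f y ∂F := (hlaw 0).integral_comp hf.aestronglyMeasurable
  rwa [e] at h

/-- The balls around a point that is not an atom have mass tending to zero with their radius. -/
lemma tendsto_measureReal_closedBall [IsFiniteMeasure F] {x : ℝ} (hx : F {x} = 0) :
    Tendsto (fun j : ℕ => F.real (Metric.closedBall x (1 / ((j : ℝ) + 1)))) atTop (𝓝 0) := by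
  have h := (tendsto_measure_cthickening_of_isClosed (μ := F) (s := {x})
    ⟨1, one_pos, measure_ne_top _ _⟩ isClosed_singleton).comp
    tendsto_one_div_add_atTop_nhds_zero_nat
  rw [hx] at h
  have h2 := (ENNReal.tendsto_toReal ENNReal.zero_ne_top).comp h
  refine h2.congr fun j => ?_
  simp only [Function.comp]
  rw [Metric.cthickening_singleton _ (by positivity)]
  rfl

/-- Almost surely, the empirical expectile is asymptotically equivalent to its linear
approximation. -/
lemma ae_tendsto_linRatio [IsProbabilityMeasure F] (hF : Integrable id F)
    (hlaw : ∀ k, HasLaw (Y k) F P) (hindep : iIndepFun Y P) {τ : ℝ} (h0 : 0 < τ) (h1 : τ < 1)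
    (hatom : F {expectile F τ} = 0) :
    ∀ᵐ ω ∂P, Tendsto (fun n => linRatio F (empiricalMeasure Y n ω) τ) atTop (𝓝 1) := by
  have hc : 0 < min τ (1 - τ) := lt_min h0 (by linarith)
  set c := min τ (1 - τ) with hcdef
  set μ := expectile F τ with hμ
  have hD := ae_tendsto_integral_empiricalMeasure hlaw hindep (continuous_ident τ μ).measurable
    (integrable_ident hF h0 h1 μ)
  have hW := ae_tendsto_integral_empiricalMeasure hlaw hindep (measurable_weight τ μ)
    (integrable_weight F τ μ)
  have hN : ∀ᵐ ω ∂P, ∀ j : ℕ, Tendsto (fun n =>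
      (empiricalMeasure Y n ω).real (Metric.closedBall μ (1 / ((j : ℝ) + 1)))) atTop
      (𝓝 (F.real (Metric.closedBall μ (1 / ((j : ℝ) + 1))))) := by
    refine ae_all_iff.2 fun j => ?_
    have hball := measurableSet_closedBall (x := μ) (ε := 1 / ((j : ℝ) + 1))
    have := ae_tendsto_integral_empiricalMeasure hlaw hindep (measurable_one.indicator hball)
      (integrable_indicator_one F hball)
    simpa only [integral_indicator_one hball] using this
  filter_upwards [hD, hW, hN] with ω hD hW hN
  rw [integral_ident_expectile hF h0 h1] at hD
  rw [integral_weight_expectile] at hW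
  rw [Metric.tendsto_atTop']
  intro ε hε
  -- a ball around `μ` small enough to carry little mass; by consistency the empirical expectile
  -- eventually stays in it
  obtain ⟨j, hj⟩ := ((tendsto_measureReal_closedBall hatom).eventually_lt_const
    (by positivity : 0 < c * ε)).exists
  have hlim : Tendsto (fun n => |∫ y, weight τ μ y ∂(empiricalMeasure Y n ω) - slope F τ|
      + (empiricalMeasure Y n ω).real (Metric.closedBall μ (1 / ((j : ℝ) + 1)))) atTop
      (𝓝 (0 + F.real (Metric.closedBall μ (1 / ((j : ℝ) + 1))))) := by
    refine Tendsto.add ?_ (hN j)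
    simpa using (hW.sub_const (slope F τ)).abs
  rw [zero_add] at hlim
  have hD' : Tendsto (fun n => |∫ y, ident τ μ y ∂(empiricalMeasure Y n ω)|) atTop (𝓝 0) := by
    simpa using hD.abs
  have hev : ∀ᶠ n in atTop, dist (linRatio F (empiricalMeasure Y n ω) τ) 1 < ε := by
    filter_upwards [hlim.eventually_lt_const hj,
      hD'.eventually_lt_const (by positivity : 0 < c * (1 / ((j : ℝ) + 1))),
      eventually_ne_atTop 0] with n hn1 hn2 hn0
    have := isProbabilityMeasure_empiricalMeasure (Y := Y) hn0 ω
    have hi := integrable_empiricalMeasure (Y := Y) id hn0 ω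
    have hδ : |expectile (empiricalMeasure Y n ω) τ - μ| ≤ 1 / ((j : ℝ) + 1) :=
      le_of_mul_le_mul_left ((mul_abs_expectile_sub_le hi h0 h1 μ).trans hn2.le) hc
    rw [Real.dist_eq]
    refine (abs_linRatio_sub_one_le F hi h0 h1 hδ).trans_lt ?_
    rw [div_lt_iff₀ hc, mul_comm ε]
    exact hn1
  obtain ⟨N, hN'⟩ := eventually_atTop.1 hev
  exact ⟨N, fun n hn => hN' n hn.le⟩

end Empirical

/-! ### A multivariate central limit theorem -/

section CLT

variable {ι : Type*} [Fintype ι] {S : Type*} [MeasurableSpace S] {ν : Measure S}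

/-- The quadratic form of the second moment matrix is the second moment of the linear
combinations. -/
lemma dotProduct_secondMoment_mulVec {g : ι → S → ℝ} (hg : ∀ i, MemLp (g i) 2 ν) (t : ι → ℝ) :
    t ⬝ᵥ (Matrix.of fun i j => ∫ y, g i y * g j y ∂ν).mulVec t
      = ∫ y, (∑ i, t i * g i y) ^ 2 ∂ν := by
  have hint : ∀ i j, Integrable (fun y => g i y * g j y) ν := fun i j => (hg i).integrable_mul (hg j)
  have e : ∀ y, (∑ i, t i * g i y) ^ 2 = ∑ i, ∑ j, t i * t j * (g i y * g j y) := by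
    intro y
    rw [sq, Finset.sum_mul_sum]
    exact Finset.sum_congr rfl fun i _ => Finset.sum_congr rfl fun j _ => by ring
  simp_rw [e]
  rw [integral_finsetSum _ fun i _ => integrable_finsetSum _ fun j _ => (hint i j).const_mul _]
  simp_rw [integral_finsetSum _ fun j _ => (hint _ j).const_mul _, integral_const_mul]
  simp only [dotProduct, Matrix.mulVec, Matrix.of_apply, Finset.mul_sum]
  exact Finset.sum_congr rfl fun i _ => Finset.sum_congr rfl fun j _ => by ring

lemma posSemidef_secondMoment {g : ι → S → ℝ} (hg : ∀ i, MemLp (g i) 2 ν) :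
    (Matrix.of fun i j => ∫ y, g i y * g j y ∂ν).PosSemidef := by
  refine Matrix.PosSemidef.of_dotProduct_mulVec_nonneg ?_ fun t => ?_
  · ext i j
    simp [mul_comm]
  · rw [star_trivial, dotProduct_secondMoment_mulVec hg]
    exact integral_nonneg fun y => sq_nonneg _

/-- The central limit theorem for centred random vectors `(g i (Y k))ᵢ`, deduced from the
one-dimensional one, applied to all linear combinations of the coordinates, and from Lévy's
continuity theorem. -/
theorem tendstoInDistribution_multivariateGaussian [DecidableEq ι] {Ω : Type*} [MeasurableSpace Ω]
    {P : Measure Ω} [IsProbabilityMeasure P] {Y : ℕ → Ω → S} (hlaw : ∀ k, HasLaw (Y k) ν P)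
    (hindep : iIndepFun Y P) {g : ι → S → ℝ} (hgm : ∀ i, Measurable (g i))
    (hg : ∀ i, MemLp (g i) 2 ν) (hg0 : ∀ i, ∫ y, g i y ∂ν = 0) :
    TendstoInDistribution
      (fun (n : ℕ) ω => (WithLp.toLp 2 fun i => (√(n : ℝ))⁻¹ * ∑ k ∈ Finset.range n, g i (Y k ω) :
        EuclideanSpace ℝ ι))
      atTop id (fun _ => P)
      (multivariateGaussian 0 (Matrix.of fun i j => ∫ y, g i y * g j y ∂ν)) := by
  have : IsProbabilityMeasure ν := (hlaw 0).isProbabilityMeasure_iff.1 inferInstance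
  set M : Matrix ι ι ℝ := Matrix.of fun i j => ∫ y, g i y * g j y ∂ν with hM
  have hmeas : ∀ n : ℕ, AEMeasurable (fun ω => (WithLp.toLp 2 fun i =>
      (√(n : ℝ))⁻¹ * ∑ k ∈ Finset.range n, g i (Y k ω) : EuclideanSpace ℝ ι)) P := fun n =>
    (WithLp.measurable_toLp 2 _).comp_aemeasurable (aemeasurable_pi_lambda _ fun i =>
      (Finset.aemeasurable_fun_sum _ fun k _ =>
        (hgm i).comp_aemeasurable (hlaw k).aemeasurable).const_mul _)
  refine ⟨hmeas, aemeasurable_id, ?_⟩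
  refine ProbabilityMeasure.tendsto_iff_tendsto_charFun.2 fun t => ?_
  set f : S → ℝ := fun y => ∑ i, t i * g i y with hf
  have hfm : Measurable f := Finset.measurable_sum _ fun i _ => (hgm i).const_mul _
  have hfL : MemLp f 2 ν := memLp_finsetSum _ fun i _ => (hg i).const_mul _
  have hf0 : ∫ y, f y ∂ν = 0 := by
    rw [hf, integral_finsetSum _ fun i _ => ((hg i).integrable one_le_two).const_mul _]
    simp [integral_const_mul, hg0]
  have hE : ∫ ω, f (Y 0 ω) ∂P = 0 :=
    ((hlaw 0).integral_comp hfm.aestronglyMeasurable).trans hf0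
  have hV : Var[fun ω => f (Y 0 ω); P] = t ⬝ᵥ M.mulVec t := by
    have hm : AEMeasurable (fun ω => f (Y 0 ω)) P := hfm.comp_aemeasurable (hlaw 0).aemeasurable
    rw [variance_of_integral_eq_zero hm hE, hM, dotProduct_secondMoment_mulVec hg]
    exact (hlaw 0).integral_comp (hfm.pow_const 2).aestronglyMeasurable
  have hclt := tendstoInDistribution_inv_sqrt_mul_sum_sub (P := P)
    (X := fun k ω => f (Y k ω)) (Y := id)
    (P' := gaussianReal 0 Var[fun ω => f (Y 0 ω); P].toNNReal) HasLaw.id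
    (by
      have : MemLp f 2 (P.map (Y 0)) := by rwa [(hlaw 0).map_eq]
      exact this.comp_of_map (hlaw 0).aemeasurable)
    (hindep.comp (fun _ => f) fun _ => hfm)
    (fun k => ((hlaw k).identDistrib (hlaw 0)).comp hfm)
  -- the characteristic function of the vectors at `t` is that of the sums of `f (Y k)` at `1`
  have h1 := ProbabilityMeasure.tendsto_iff_tendsto_charFun.1 hclt.tendsto 1
  simp only [hE, mul_zero, sub_zero, ProbabilityMeasure.coe_mk, Measure.map_id] at h1 ⊢
  rw [charFun_gaussianReal, hV] at h1
  have hq : 0 ≤ t ⬝ᵥ M.mulVec t := by rw [← hV]; exact variance_nonneg _ _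
  rw [charFun_multivariateGaussian (posSemidef_secondMoment hg)]
  have hlim : Complex.exp ((1 : ℝ) * (0 : ℝ) * Complex.I
      - ((t ⬝ᵥ M.mulVec t).toNNReal : ℝ) * (1 : ℝ) ^ 2 / 2)
      = Complex.exp ((inner ℝ t 0 : ℝ) * Complex.I - (t ⬝ᵥ M.mulVec t : ℝ) / 2) := by
    rw [Real.coe_toNNReal _ hq]
    simp
  refine (hlim ▸ h1).congr fun n => ?_
  rw [charFun_apply, charFun_apply, integral_map (hmeas n) (by fun_prop),
    integral_map (hclt.forall_aemeasurable n |>.congr (by simp [hE])) (by fun_prop)]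
  refine integral_congr_ae (ae_of_all _ fun ω => ?_)
  have : inner ℝ ((√(n : ℝ))⁻¹ * ∑ k ∈ Finset.range n, f (Y k ω)) (1 : ℝ)
      = inner ℝ (WithLp.toLp 2 fun i => (√(n : ℝ))⁻¹ * ∑ k ∈ Finset.range n, g i (Y k ω) :
        EuclideanSpace ℝ ι) t := by
    simp only [PiLp.inner_apply, hf, RCLike.inner_apply, conj_trivial, one_mul]
    rw [Finset.sum_comm, Finset.mul_sum]
    refine Finset.sum_congr rfl fun i _ => ?_
    rw [← Finset.mul_sum]
    ring
  simp only [this]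

end CLT

end Expectile

open Expectile in
theorem mainTheorem6 {Ω : Type*} [MeasurableSpace Ω] (P : Measure Ω) [IsProbabilityMeasure P]
    (F : Measure ℝ) [IsProbabilityMeasure F] (hF : Integrable (fun y : ℝ => y ^ 2) F)
    (Y : ℕ → Ω → ℝ) (hlaw : ∀ k, HasLaw (Y k) F P) (hindep : iIndepFun Y P)
    (m : ℕ) (τ : Fin m → ℝ) (hτ : ∀ i, 0 < τ i ∧ τ i < 1)
    (hatom : ∀ i, F {Expectile.expectile F (τ i)} = 0) :
    (Expectile.asympCov F τ).PosSemidef ∧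
      TendstoInDistribution
        (fun (n : ℕ) (ω : Ω) =>
          (WithLp.toLp 2 fun i : Fin m =>
            √(n : ℝ) * (Expectile.sampleExpectile Y (τ i) n ω - Expectile.expectile F (τ i)) :
            EuclideanSpace ℝ (Fin m)))
        atTop id (fun _ => P) (multivariateGaussian 0 (Expectile.asympCov F τ)) := by
  have hF2 : MemLp id 2 F := (memLp_two_iff_integrable_sq aestronglyMeasurable_id).2 hF
  have hF1 : Integrable id F := hF2.integrable one_le_two
  have hY : ∀ k, AEMeasurable (Y k) P := fun k => (hlaw k).aemeasurable
  set g : Fin m → ℝ → ℝ := fun i y => ident (τ i) (expectile F (τ i)) y / slope F (τ i) with hgdef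
  have hgm : ∀ i, Measurable (g i) := fun i => (continuous_ident _ _).measurable.div_const _
  have hg : ∀ i, MemLp (g i) 2 F := fun i => by
    simpa only [hgdef, div_eq_inv_mul] using
      (memLp_two_ident hF2 (hτ i).1 (hτ i).2 (expectile F (τ i))).const_mul (slope F (τ i))⁻¹
  have hg0 : ∀ i, ∫ y, g i y ∂F = 0 := fun i => by
    rw [hgdef, integral_div, integral_ident_expectile hF1 (hτ i).1 (hτ i).2, zero_div]
  have hcov : asympCov F τ = Matrix.of fun i j => ∫ y, g i y * g j y ∂F := by
    ext i j
    simp only [asympCov, Matrix.of_apply, hgdef, div_mul_div_comm, integral_div]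
  rw [hcov]
  refine ⟨posSemidef_secondMoment hg, ?_⟩
  have hclt := tendstoInDistribution_multivariateGaussian hlaw hindep hgm hg hg0
  have hB : ∀ n : ℕ, AEMeasurable (fun ω => (WithLp.toLp 2 fun i : Fin m =>
      linRatio F (empiricalMeasure Y n ω) (τ i) : EuclideanSpace ℝ (Fin m))) P := fun n =>
    (WithLp.measurable_toLp 2 _).comp_aemeasurable (aemeasurable_pi_lambda _ fun i =>
      aemeasurable_linRatio_empiricalMeasure hY (hτ i).1 (hτ i).2 n)
  have hratio : TendstoInMeasure P (fun (n : ℕ) ω => (WithLp.toLp 2 fun i : Fin m =>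
      linRatio F (empiricalMeasure Y n ω) (τ i) : EuclideanSpace ℝ (Fin m))) atTop
      (fun _ => WithLp.toLp 2 fun _ => 1) := by
    refine tendstoInMeasure_of_tendsto_ae
      (fun n => (hB n).aestronglyMeasurable) ?_
    have hae := ae_all_iff.2 fun i =>
      ae_tendsto_linRatio hF1 hlaw hindep (hτ i).1 (hτ i).2 (hatom i)
    filter_upwards [hae] with ω hω
    exact ((PiLp.continuous_toLp 2 _).tendsto _).comp (tendsto_pi_nhds.2 hω)
  have hmul : Continuous fun p : EuclideanSpace ℝ (Fin m) × EuclideanSpace ℝ (Fin m) =>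
      (WithLp.toLp 2 fun i => p.1 i * p.2 i : EuclideanSpace ℝ (Fin m)) := by fun_prop
  refine (hclt.continuous_comp_prodMk_of_tendstoInMeasure_const hmul hratio hB).congr
    (fun n => ae_of_all _ fun ω => ?_) (ae_of_all _ fun z => by simp)
  ext i
  simp only
  rcases eq_or_ne n 0 with rfl | hn
  · simp
  have := isProbabilityMeasure_empiricalMeasure (Y := Y) hn ω
  have hn' : √(n : ℝ) ≠ 0 := Real.sqrt_ne_zero'.2 (by positivity)
  rw [sampleExpectile, expectile_sub_eq_mul_linRatio F (integrable_empiricalMeasure id hn ω)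
    (hτ i).1 (hτ i).2, integral_empiricalMeasure]
  simp only [hgdef]
  -- what remains is `(√n)⁻¹ = √n / n`
  rw [← Finset.sum_div, ← mul_assoc]
  congr 1
  nth_rw 3 [← Real.sq_sqrt (Nat.cast_nonneg n : (0 : ℝ) ≤ n)]
  field_simp
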